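/- Let $R$ be a commutative ring graded by an abelian group $A$ (for $A=0$: any commutative ring), let $a\in A$, and let $d\ge 0$ be an integer. A *differential module* is an $R$-module with a decomposition $D=\bigoplus_{b\in A,\ j\in\mathbb Z/d} D_{b,j}$ such that $R_b\cdot D_{c,j}\subseteq D_{b+c,j}$, together with an $R$-linear map $d^D:D\to D$ such that $(d^D)^2=0$ and $d^D(D_{b,j})\subseteq D_{b+a,j-1}$. (For $d=1$ and $A=0$ this is a module with a square-zero endomorphism.) A *morphism* $\phi:D\to D'$ of differential modules is an $R$-linear map with $\phi(D_{b,j})\subseteq D'_{b,j}$ and $d^{D'}\phi=\phi d^D$. A *flag* is a differential module $D$ with an exhaustive filtration $0=D^{-1}\subseteq D^0\subseteq D^1\subseteq\cdots$, $\bigcup_i D^i=D$, by graded submodules such that $d^D(D^i)\subseteq D^{i-1}$ for all $i$. It is *$R$-projective* if every quotient $D^i/D^{i-1}$ is a projective $R$-module. Its *anchor* is the complex $$\cdots\to D^2/D^1\to D^1/D^0\to D^0\to 0$$ with the differential induced by $d^D$ (it is the direct sum of its graded strands), and $D$ is *anchored on a resolution* if the homology of the anchor vanishes in all degrees $i\neq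 0$. A map $\psi:D\to D'$ of flags is *flag-preserving* if $\psi(D^i)\subseteq D'^i$ for all $i$. **Theorem.** Let $D$ and $D'$ be $R$-projective flags anchored on resolutions, and let $\phi:D\to D'$ be any morphism of differential modules, not necessarily flag-preserving. Then there exist a flag-preserving morphism of differential modules $\psi:D\to D'$ and an $R$-linear map $h:D\to D'$ with $h(D_{b,j})\subseteq D'_{b-a,j+1}$ such that $$\phi-\psi=d^{D'}h+h\,d^D.$$ No finiteness assumption is made on $R$, $D$ or $D'$. -/

import Mathlib

/-!
`R` is a commutative ring graded by an abelian group `A` (the auxiliary grading; for `A` trivial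
this is a plain commutative ring), `a : A` is the auxiliary degree of the differentials, and `d`
is the modulus of the ambient `ℤ/d`-grading (`d = 1`: no grading; `d = 0`: a `ℤ`-grading).
-/

universe u v w t

namespace DiffMod

/-- A `ℤ/d`-graded differential `R`-module, homogeneous of degree `a` for the auxiliary grading:
a graded module `⨁ piece (b, j)`, `b : A`, `j : ℤ/d`, with a square-zero `R`-linear endomorphism of
auxiliary degree `a` and `ℤ/d`-degree `-1`. The ring `R` lies in `ℤ/d`-degree `0`. -/
structure DM {R : Type u} [CommRing R] {A : Type t} [AddCommGroup A] [DecidableEq A]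
    (𝓡 : A → AddSubgroup R) (a : A) (d : ℕ) where
  carrier : Type v
  [addCommGroup : AddCommGroup carrier]
  [module : Module R carrier]
  piece : A × ZMod d → AddSubgroup carrier
  [decomposition : DirectSum.Decomposition piece]
  smul_mem : ∀ (b c : A) (j : ZMod d) (r : R) (x : carrier),
    r ∈ 𝓡 b → x ∈ piece (c, j) → r • x ∈ piece (b + c, j)
  diff : carrier →ₗ[R] carrier
  diff_mem : ∀ (b : A) (j : ZMod d) (x : carrier),
    x ∈ piece (b, j) → diff x ∈ piece (b + a, j - 1)
  diff_diff : ∀ x : carrier, diff (diff x) = 0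

attribute [instance] DM.addCommGroup DM.module DM.decomposition

variable {R : Type u} [CommRing R] {A : Type t} [AddCommGroup A] [DecidableEq A]
  {𝓡 : A → AddSubgroup R} {a : A} {d : ℕ}

/-- An `R`-linear map is a morphism of graded differential modules if it has degree `0` for both
gradings and commutes with the differentials. -/
structure IsMorphism (D : DM.{u, v, t} 𝓡 a d) (D' : DM.{u, w, t} 𝓡 a d)
    (φ : D.carrier →ₗ[R] D'.carrier) : Prop where
  map_mem : ∀ (b : A) (j : ZMod d) (x : D.carrier), x ∈ D.piece (b, j) → φ x ∈ D'.piece (b, j)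
  comm : ∀ x : D.carrier, D'.diff (φ x) = φ (D.diff x)

/-- `h` is a homotopy from `φ` to `ψ`: it has `ℤ/d`-degree `1` and auxiliary degree `-a`
(opposite to the differentials), and `φ - ψ = d h + h d`. -/
structure IsHomotopy (D : DM.{u, v, t} 𝓡 a d) (D' : DM.{u, w, t} 𝓡 a d)
    (φ ψ h : D.carrier →ₗ[R] D'.carrier) : Prop where
  map_mem : ∀ (b : A) (j : ZMod d) (x : D.carrier),
    x ∈ D.piece (b, j) → h x ∈ D'.piece (b - a, j + 1)
  eq : φ - ψ = D'.diff ∘ₗ h + h ∘ₗ D.diff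

/-- A flag: a graded differential module with an exhaustive filtration
`0 = fil (-1) ≤ fil 0 ≤ fil 1 ≤ ⋯` by graded submodules, strictly lowered by the differential. -/
structure Flag {R : Type u} [CommRing R] {A : Type t} [AddCommGroup A] [DecidableEq A]
    (𝓡 : A → AddSubgroup R) (a : A) (d : ℕ) extends DM.{u, v, t} 𝓡 a d where
  fil : ℤ → Submodule R carrier
  fil_homogeneous : ∀ i : ℤ, (fil i).IsHomogeneous piece
  fil_mono : Monotone fil
  fil_neg : ∀ i : ℤ, i < 0 → fil i = ⊥
  fil_exhaustive : ∀ x : carrier, ∃ i : ℤ, x ∈ fil i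
  diff_fil : ∀ (i : ℤ) (x : carrier), x ∈ fil i → diff x ∈ fil (i - 1)

namespace Flag

/-- The `i`-th module `fil i / fil (i - 1)` of the anchor (summed over all internal degrees). -/
abbrev gr (D : Flag.{u, v, t} 𝓡 a d) (i : ℤ) : Type v :=
  D.fil i ⧸ (D.fil (i - 1)).submoduleOf (D.fil i)

/-- The differential of `D` as a map `fil i → fil j` for `j = i - 1`. -/
def diffFil (D : Flag.{u, v, t} 𝓡 a d) (i j : ℤ) (hij : j + 1 = i) : D.fil i →ₗ[R] D.fil j :=
  D.diff.restrict fun x hx => by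
    obtain rfl : j = i - 1 := by omega
    exact D.diff_fil i x hx

/-- The differential `gr i → gr j`, `j = i - 1`, of the anchor, induced by that of `D`. -/
def anchorDiff (D : Flag.{u, v, t} 𝓡 a d) (i j : ℤ) (hij : j + 1 = i) : D.gr i →ₗ[R] D.gr j :=
  Submodule.mapQ _ _ (D.diffFil i j hij) fun x hx => by
    obtain rfl : j = i - 1 := by omega
    exact D.diff_fil (i - 1) x.1 hx

theorem anchorDiff_comp (D : Flag.{u, v, t} 𝓡 a d) (i j k : ℤ) (hij : j + 1 = i)
    (hjk : k + 1 = j) (x : D.gr i) : D.anchorDiff j k hjk (D.anchorDiff i j hij x) = 0 := by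
  obtain ⟨y, rfl⟩ := Submodule.Quotient.mk_surjective _ x
  have : D.diffFil j k hjk (D.diffFil i j hij y) = 0 := Subtype.ext (D.diff_diff y.1)
  simp [anchorDiff, this]

/-- A projective flag: all associated graded pieces of the filtration are projective modules. -/
def IsProjective (D : Flag.{u, v, t} 𝓡 a d) : Prop :=
  ∀ i : ℤ, Module.Projective R (D.gr i)

/-- The anchor is a resolution: its homology is concentrated in degree `0`. -/
def AnchoredOnResolution (D : Flag.{u, v, t} 𝓡 a d) : Prop :=
  ∀ i : ℤ, i ≠ 0 → Function.Exact
    (D.anchorDiff (i + 1) i rfl) (D.anchorDiff i (i - 1) (sub_add_cancel i 1))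

/-- A linear map between flags is flag-preserving if it maps `fil i` into `fil i` for all `i`. -/
def FlagPreserving (D : Flag.{u, v, t} 𝓡 a d) (D' : Flag.{u, w, t} 𝓡 a d)
    (φ : D.carrier →ₗ[R] D'.carrier) : Prop :=
  ∀ (i : ℤ) (x : D.carrier), x ∈ D.fil i → φ x ∈ D'.fil i

end Flag

end DiffMod

/-!
For `x ∈ fil i` the element `d (φ x) = φ (d x)` lies in `fil (i - 1)` as soon as `φ` preserves
`fil (i - 1)`, and exactness of the anchor of `D'` in positive degrees then makes `φ x` a boundary
modulo `fil i`. Since `gr i` is projective, the boundary can be chosen as `d (u x)` for a linear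
`u : D → D'` that vanishes on `fil (i - 1)`, and `φ - (d u + u d)` preserves `fil i`. These
successive corrections `u` add up to a linear map `h` for which `φ - (d h + h d)` is
flag-preserving. Replacing `h` by its homogeneous component of the degree opposite to the
differentials replaces `φ - (d h + h d)` by its component of degree zero, which still preserves
every `fil i` because `fil i` is homogeneous.
-/

namespace DiffMod

section Extension

variable {R : Type*} [Ring R] {M N P Q : Type*} [AddCommGroup M] [AddCommGroup N]
  [AddCommGroup P] [AddCommGroup Q] [Module R M] [Module R N] [Module R P] [Module R Q]

theorem exists_comp_eq_of_range_le [Module.Projective R P] (f : P →ₗ[R] Q) (g : M →ₗ[R] Q)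
    (hfg : LinearMap.range f ≤ LinearMap.range g) : ∃ k : P →ₗ[R] M, g ∘ₗ k = f := by
  obtain ⟨k, hk⟩ := Module.projective_lifting_property g.rangeRestrict
    (f.codRestrict (LinearMap.range g) fun p => hfg ⟨p, rfl⟩) g.surjective_rangeRestrict
  exact ⟨k, LinearMap.ext fun p => congrArg Subtype.val (LinearMap.congr_fun hk p)⟩

theorem exists_comp_subtype_eq (S : Submodule R M) [Module.Projective R (M ⧸ S)]
    (f : S →ₗ[R] N) : ∃ F : M →ₗ[R] N, F ∘ₗ S.subtype = f := by
  have hsection : ∃ s, S.mkQ ∘ₗ s = LinearMap.id :=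
    Module.projective_lifting_property S.mkQ LinearMap.id S.mkQ_surjective
  obtain ⟨r, hr⟩ : ∃ r, r ∘ₗ S.subtype = LinearMap.id :=
    (((LinearMap.exact_subtype_mkQ S).split_tfae S.subtype_injective
      S.mkQ_surjective).out 0 1).1 hsection
  exact ⟨f ∘ₗ r, by rw [LinearMap.comp_assoc, hr, LinearMap.comp_id]⟩

theorem exists_linearMap_of_directed {ι : Type*} [Nonempty ι] (f : ι → M →ₗ.[R] N)
    (hf : Directed (· ≤ ·) f) (hdom : ∀ x, ∃ i, x ∈ (f i).domain) :
    ∃ F : M →ₗ[R] N, ∀ i (x : (f i).domain), F x = f i x := by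
  have hdir : DirectedOn (· ≤ ·) (Set.range f) := hf.directedOn_range
  have htotal (x : M) : x ∈ (LinearPMap.sSup _ hdir).domain := by
    simpa only [LinearPMap.mem_domain_sSup_iff (Set.range_nonempty f), Set.exists_range_iff]
      using hdom x
  exact ⟨(LinearPMap.sSup _ hdir).toFun ∘ₗ LinearMap.id.codRestrict _ htotal,
    fun i x => LinearPMap.sSup_apply hdir ⟨i, rfl⟩ x⟩

theorem exists_extension_of_projective_subquotients (S : ℕ → Submodule R M) (hS : Monotone S)
    (hexh : ∀ x, ∃ n, x ∈ S n)
    (hproj : ∀ n, Module.Projective R (S (n + 1) ⧸ (S n).submoduleOf (S (n + 1))))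
    (f : S 0 →ₗ[R] N) : ∃ F : M →ₗ[R] N, ∀ x : S 0, F x = f x := by
  have hstep (n : ℕ) (g : S n →ₗ[R] N) : ∃ g' : S (n + 1) →ₗ[R] N,
      (⟨S n, g⟩ : M →ₗ.[R] N) ≤ ⟨S (n + 1), g'⟩ := by
    have hle : S n ≤ S (n + 1) := hS n.le_succ
    obtain ⟨g', hg'⟩ := exists_comp_subtype_eq ((S n).submoduleOf (S (n + 1)))
      (g ∘ₗ (Submodule.submoduleOfEquivOfLe hle).toLinearMap)
    refine ⟨g', hle, fun x ⟨y, hy⟩ hxy => ?_⟩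
    obtain rfl : (x : M) = y := hxy
    exact (LinearMap.congr_fun hg' ⟨⟨x, hy⟩, x.2⟩).symm
  choose next hnext using hstep
  let g (n : ℕ) : S n →ₗ[R] N := Nat.rec f next n
  have hg : Monotone fun n => (⟨S n, g n⟩ : M →ₗ.[R] N) :=
    monotone_nat_of_le_succ fun n => hnext n (g n)
  obtain ⟨F, hF⟩ := exists_linearMap_of_directed _ hg.directed_le hexh
  exact ⟨F, hF 0⟩

end Extension

section HomogeneousComponent

variable {G M N : Type*} [DecidableEq G] [AddCommMonoid M] [AddCommMonoid N]
  {σ τ : Type*} [SetLike σ M] [AddSubmonoidClass σ M] [SetLike τ N] [AddSubmonoidClass τ N]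
  (𝓜 : G → σ) (𝓝 : G → τ)

/-- An additive map between graded additive monoids is homogeneous of degree `g` if it raises
degrees by `g`. -/
def IsHomogeneousHom [Add G] (g : G) (f : M →+ N) : Prop :=
  ∀ ⦃i x⦄, x ∈ 𝓜 i → f x ∈ 𝓝 (i + g)

variable [DirectSum.Decomposition 𝓜] [DirectSum.Decomposition 𝓝]

theorem addMonoidHom_ext_of_homogeneous {f f' : M →+ N} (h : ∀ i, ∀ x ∈ 𝓜 i, f x = f' x) :
    f = f' := by
  ext x
  induction x using DirectSum.Decomposition.inductionOn 𝓜 with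
  | zero => simp only [map_zero]
  | @homogeneous i m => exact h i m m.2
  | add x y hx hy => simp only [map_add, hx, hy]

/-- The projection of a graded additive monoid onto its piece of degree `i`, as an
endomorphism. -/
def gradedProj (i : G) : M →+ M :=
  ((AddSubmonoidClass.subtype (𝓜 i)).comp (DFinsupp.evalAddMonoidHom i)).comp
    (DirectSum.decomposeAddEquiv 𝓜).toAddMonoidHom

theorem gradedProj_apply (i : G) (x : M) :
    gradedProj 𝓜 i x = DirectSum.decompose 𝓜 x i := rfl

theorem gradedProj_mem (i : G) (x : M) : gradedProj 𝓜 i x ∈ 𝓜 i :=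
  (DirectSum.decompose 𝓜 x i).2

variable {𝓜 𝓝} in
theorem IsHomogeneousHom.gradedProj_map [Add G] [IsRightCancelAdd G] {g : G} {f : M →+ N}
    (hf : IsHomogeneousHom 𝓜 𝓝 g f) (i : G) (x : M) :
    gradedProj 𝓝 (i + g) (f x) = f (gradedProj 𝓜 i x) := by
  suffices (gradedProj 𝓝 (i + g)).comp f = f.comp (gradedProj 𝓜 i) from DFunLike.congr_fun this x
  refine addMonoidHom_ext_of_homogeneous 𝓜 fun k m hm => ?_
  simp only [AddMonoidHom.comp_apply, gradedProj_apply]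
  obtain rfl | hki := eq_or_ne k i
  · rw [DirectSum.decompose_of_mem_same 𝓝 (hf hm), DirectSum.decompose_of_mem_same 𝓜 hm]
  · rw [DirectSum.decompose_of_mem_ne 𝓜 hm hki, map_zero,
      DirectSum.decompose_of_mem_ne 𝓝 (hf hm) ((add_left_injective g).ne hki)]

/-- The homogeneous component of degree `g` of an additive map `f` between graded additive
monoids: on the piece of degree `i` it is `f` followed by the projection to degree `i + g`. -/
def homogeneousComponent [Add G] (g : G) (f : M →+ N) : M →+ N :=
  (DirectSum.toAddMonoid fun i =>
    (gradedProj 𝓝 (i + g)).comp (f.comp (AddSubmonoidClass.subtype (𝓜 i)))).comp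
    (DirectSum.decomposeAddEquiv 𝓜).toAddMonoidHom

theorem homogeneousComponent_of_mem [Add G] (g : G) (f : M →+ N) {i : G} {x : M}
    (hx : x ∈ 𝓜 i) : homogeneousComponent 𝓜 𝓝 g f x = gradedProj 𝓝 (i + g) (f x) := by
  simp [homogeneousComponent, DirectSum.decompose_of_mem 𝓜 hx]

theorem isHomogeneousHom_homogeneousComponent [Add G] (g : G) (f : M →+ N) :
    IsHomogeneousHom 𝓜 𝓝 g (homogeneousComponent 𝓜 𝓝 g f) := fun _ _ hx => by
  rw [homogeneousComponent_of_mem 𝓜 𝓝 g f hx]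
  exact gradedProj_mem 𝓝 _ _

theorem homogeneousComponent_mem [Add G] {S T : Type*} [SetLike S M] [AddSubmonoidClass S M]
    [SetLike T N] [AddSubmonoidClass T N] {p : S} {q : T}
    (hp : DirectSum.SetLike.IsHomogeneous 𝓜 p) (hq : DirectSum.SetLike.IsHomogeneous 𝓝 q) (g : G)
    {f : M →+ N} (hf : ∀ x ∈ p, f x ∈ q) {x : M} (hx : x ∈ p) :
    homogeneousComponent 𝓜 𝓝 g f x ∈ q := by
  classical
  rw [← DirectSum.sum_support_decompose 𝓜 x, map_sum]
  refine sum_mem fun i _ => ?_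
  rw [homogeneousComponent_of_mem 𝓜 𝓝 g f (SetLike.coe_mem _)]
  exact hq _ (hf _ (hp i hx))

variable {𝓜 𝓝} in
theorem homogeneousComponent_comp_eq_comp [AddCommSemigroup G] [IsRightCancelAdd G] {e : G}
    {u : M →+ M} {u' : N →+ N} (hu : IsHomogeneousHom 𝓜 𝓜 e u) (hu' : IsHomogeneousHom 𝓝 𝓝 e u')
    {f : M →+ N} (hf : f.comp u = u'.comp f) (g : G) :
    (homogeneousComponent 𝓜 𝓝 g f).comp u = u'.comp (homogeneousComponent 𝓜 𝓝 g f) :=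
  addMonoidHom_ext_of_homogeneous 𝓜 fun i x hx => by
    have hfx : f (u x) = u' (f x) := DFunLike.congr_fun hf x
    simp only [AddMonoidHom.comp_apply, homogeneousComponent_of_mem 𝓜 𝓝 g f hx,
      homogeneousComponent_of_mem 𝓜 𝓝 g f (hu hx), hfx, add_right_comm i e g, hu'.gradedProj_map]

end HomogeneousComponent

variable {R : Type u} [CommRing R] {A : Type t} [AddCommGroup A] [DecidableEq A]
  {𝓡 : A → AddSubgroup R} {a : A} {d : ℕ}

namespace DM

theorem isHomogeneousHom_diff (D : DM.{u, v, t} 𝓡 a d) :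
    IsHomogeneousHom D.piece D.piece (a, -1) D.diff.toAddMonoidHom := fun i _ hx => by
  simpa [Prod.add_def, sub_eq_add_neg] using D.diff_mem i.1 i.2 _ hx

theorem isHomogeneousHom_smul (D : DM.{u, v, t} 𝓡 a d) {b : A} {r : R} (hr : r ∈ 𝓡 b) :
    IsHomogeneousHom D.piece D.piece (b, 0) (DistribSMul.toAddMonoidHom D.carrier r) :=
  fun i _ hx => by
    simpa [Prod.add_def, add_comm b] using D.smul_mem b i.1 i.2 r _ hr hx

variable (D : DM.{u, v, t} 𝓡 a d) (D' : DM.{u, w, t} 𝓡 a d)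

/-- The homogeneous component of degree `g` of an `R`-linear map between graded modules. -/
def component [DirectSum.Decomposition 𝓡] (g : A × ZMod d) (f : D.carrier →ₗ[R] D'.carrier) :
    D.carrier →ₗ[R] D'.carrier where
  __ := homogeneousComponent D.piece D'.piece g f.toAddMonoidHom
  map_smul' r x := by
    let F := homogeneousComponent D.piece D'.piece g f.toAddMonoidHom
    change F (r • x) = r • F x
    induction r using DirectSum.Decomposition.inductionOn 𝓡 with
    | zero => simp only [zero_smul, map_zero]
    | add r s hr hs => simp only [add_smul, map_add, hr, hs]
    | @homogeneous b r =>
      have hsmul : f.toAddMonoidHom.comp (DistribSMul.toAddMonoidHom D.carrier (r : R)) =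
          (DistribSMul.toAddMonoidHom D'.carrier (r : R)).comp f.toAddMonoidHom :=
        AddMonoidHom.ext fun x => f.map_smul r x
      exact DFunLike.congr_fun (homogeneousComponent_comp_eq_comp
        (D.isHomogeneousHom_smul r.2) (D'.isHomogeneousHom_smul r.2) hsmul g) x

variable {D D'}

theorem component_of_mem [DirectSum.Decomposition 𝓡] (g : A × ZMod d)
    (f : D.carrier →ₗ[R] D'.carrier) {i : A × ZMod d} {x : D.carrier} (hx : x ∈ D.piece i) :
    D.component D' g f x = gradedProj D'.piece (i + g) (f x) :=
  homogeneousComponent_of_mem D.piece D'.piece g _ hx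

theorem component_mem [DirectSum.Decomposition 𝓡] (g : A × ZMod d)
    (f : D.carrier →ₗ[R] D'.carrier) {i : A × ZMod d} {x : D.carrier} (hx : x ∈ D.piece i) :
    D.component D' g f x ∈ D'.piece (i + g) :=
  isHomogeneousHom_homogeneousComponent D.piece D'.piece g f.toAddMonoidHom hx

/-- The map `φ - (d h + h d)`, to which `h` is a homotopy from `φ`. -/
def deform (φ h : D.carrier →ₗ[R] D'.carrier) : D.carrier →ₗ[R] D'.carrier :=
  φ - (D'.diff ∘ₗ h + h ∘ₗ D.diff)

theorem deform_apply (φ h : D.carrier →ₗ[R] D'.carrier) (x : D.carrier) :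
    deform φ h x = φ x - (D'.diff (h x) + h (D.diff x)) := rfl

theorem deform_deform (φ h h' : D.carrier →ₗ[R] D'.carrier) :
    deform (deform φ h) h' = deform φ (h + h') := by
  simp only [deform, LinearMap.comp_add, LinearMap.add_comp]
  abel

theorem diff_deform {φ : D.carrier →ₗ[R] D'.carrier} (hφ : ∀ x, D'.diff (φ x) = φ (D.diff x))
    (h : D.carrier →ₗ[R] D'.carrier) (x : D.carrier) :
    D'.diff (deform φ h x) = deform φ h (D.diff x) := by
  simp only [deform_apply, map_sub, map_add, map_zero, D.diff_diff, D'.diff_diff, hφ, zero_add,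
    add_zero]

theorem component_deform [DirectSum.Decomposition 𝓡] {φ : D.carrier →ₗ[R] D'.carrier}
    (hφ : IsHomogeneousHom D.piece D'.piece 0 φ.toAddMonoidHom)
    (h : D.carrier →ₗ[R] D'.carrier) :
    D.component D' 0 (deform φ h) = deform φ (D.component D' (-a, 1) h) := by
  refine LinearMap.toAddMonoidHom_injective (addMonoidHom_ext_of_homogeneous D.piece ?_)
  intro i x hx
  have hφx : gradedProj D'.piece i (φ x) = φ x :=
    DirectSum.decompose_of_mem_same D'.piece (add_zero i ▸ hφ hx)
  have hdiff : gradedProj D'.piece i (D'.diff (h x)) =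
      D'.diff (gradedProj D'.piece (i + (-a, 1)) (h x)) := by
    have hdeg : i + (-a, 1) + (a, -1) = i := by ext <;> simp
    have hproj := D'.isHomogeneousHom_diff.gradedProj_map (i + (-a, 1)) (h x)
    rwa [hdeg] at hproj
  have hcomp : D.component D' (-a, 1) h (D.diff x) = gradedProj D'.piece i (h (D.diff x)) := by
    have hdeg : i + (a, -1) + (-a, 1) = i := by ext <;> simp
    have hdx : D.diff x ∈ D.piece (i + (a, -1)) := D.isHomogeneousHom_diff hx
    rw [component_of_mem _ h hdx, hdeg]
  change D.component D' 0 (deform φ h) x = deform φ (D.component D' (-a, 1) h) x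
  rw [component_of_mem 0 _ hx, add_zero, deform_apply, deform_apply, component_of_mem _ h hx,
    hcomp, map_sub, map_add, hφx, hdiff]

end DM

theorem IsMorphism.isHomogeneousHom {D : DM.{u, v, t} 𝓡 a d} {D' : DM.{u, w, t} 𝓡 a d}
    {φ : D.carrier →ₗ[R] D'.carrier} (hφ : IsMorphism D D' φ) :
    IsHomogeneousHom D.piece D'.piece 0 φ.toAddMonoidHom := fun i x hx => by
  rw [add_zero]
  exact hφ.map_mem i.1 i.2 x hx

namespace Flag

section Anchor

variable (D : Flag.{u, v, t} 𝓡 a d)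

theorem exists_linearMap_extending (hD : D.IsProjective) {N : Type*} [AddCommGroup N]
    [Module R N] (i : ℤ) (f : D.fil i →ₗ[R] N) :
    ∃ F : D.carrier →ₗ[R] N, ∀ x : D.fil i, F x = f x := by
  have hzero : D.fil (i + (0 : ℕ)) = D.fil i := by rw [Nat.cast_zero, add_zero]
  have hproj (n : ℕ) : Module.Projective R (D.fil (i + (n + 1 : ℕ)) ⧸
      (D.fil (i + n)).submoduleOf (D.fil (i + (n + 1 : ℕ)))) := by
    have hpred : i + n = i + (n + 1 : ℕ) - 1 := by omega
    exact hpred ▸ hD (i + (n + 1 : ℕ))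
  obtain ⟨F, hF⟩ := exists_extension_of_projective_subquotients (fun n : ℕ => D.fil (i + n))
    (fun m n hmn => D.fil_mono (by omega))
    (fun x => (D.fil_exhaustive x).imp' (fun k => (k - i).toNat) fun k => (D.fil_mono (by omega) ·))
    hproj (f ∘ₗ Submodule.inclusion hzero.le)
  exact ⟨F, fun x => hF ⟨x, hzero.ge x.2⟩⟩

theorem exists_sub_diff_mem_fil_pred (hD : D.AnchoredOnResolution) {i : ℤ} (hi : i ≠ 0)
    {y : D.carrier} (hy : y ∈ D.fil i) (hdy : D.diff y ∈ D.fil (i - 1 - 1)) :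
    ∃ z, y - D.diff z ∈ D.fil (i - 1) := by
  have hcycle : D.anchorDiff i (i - 1) (sub_add_cancel i 1)
      (Submodule.Quotient.mk ⟨y, hy⟩) = 0 :=
    (Submodule.Quotient.mk_eq_zero _).2 hdy
  obtain ⟨w, hw⟩ := (hD i hi _).1 hcycle
  obtain ⟨z, rfl⟩ := Submodule.Quotient.mk_surjective _ w
  have hsub := (Submodule.Quotient.eq _).1 hw.symm
  exact ⟨z, hsub⟩

theorem exists_sub_diff_mem_fil (hD : D.AnchoredOnResolution) {i : ℤ} (hi : 0 ≤ i)
    {y : D.carrier} (hdy : D.diff y ∈ D.fil (i - 1)) : ∃ z, y - D.diff z ∈ D.fil i := by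
  obtain ⟨j, hj⟩ := D.fil_exhaustive y
  obtain ⟨k, hik, hk⟩ : ∃ k, i ≤ k ∧ y ∈ D.fil k :=
    ⟨max i j, le_max_left i j, D.fil_mono (le_max_right i j) hj⟩
  clear hj
  induction k, hik using Int.leInduction generalizing y with
  | base => exact ⟨0, by simpa using hk⟩
  | succ k hik ih =>
    obtain ⟨z, hz⟩ := D.exists_sub_diff_mem_fil_pred hD (by omega) hk
      (D.fil_mono (by omega) hdy)
    rw [add_sub_cancel_right] at hz
    have hdy' : D.diff (y - D.diff z) ∈ D.fil (i - 1) := by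
      rwa [map_sub, D.diff_diff, sub_zero]
    obtain ⟨z', hz'⟩ := ih hdy' hz
    exact ⟨z + z', by rwa [map_add, ← sub_sub]⟩

end Anchor

section Homotopy

variable (D : Flag.{u, v, t} 𝓡 a d) (D' : Flag.{u, w, t} 𝓡 a d)

/-- A linear map between flags is flag-preserving up to `i` if it maps `fil k` into `fil k` for
all `k ≤ i`; unlike `FlagPreserving` this can be established one step of the filtration at a
time. -/
def FlagPreservingUpTo (i : ℤ) (φ : D.carrier →ₗ[R] D'.carrier) : Prop :=
  ∀ k ≤ i, ∀ x ∈ D.fil k, φ x ∈ D'.fil k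

variable {D D'}

theorem exists_gr_lift_boundary (hD : D.IsProjective) (hD' : D'.AnchoredOnResolution)
    {φ : D.carrier →ₗ[R] D'.carrier} (hφ : ∀ x, D'.diff (φ x) = φ (D.diff x)) {i : ℤ}
    (hi : 0 ≤ i) (hφi : ∀ x ∈ D.fil (i - 1), φ x ∈ D'.fil (i - 1)) :
    ∃ g : D.gr i →ₗ[R] D'.carrier,
      ∀ x : D.fil i, φ x - D'.diff (g (Submodule.Quotient.mk x)) ∈ D'.fil i := by
  have := hD i
  let φbar : D.gr i →ₗ[R] D'.carrier ⧸ D'.fil i :=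
    ((D.fil (i - 1)).submoduleOf (D.fil i)).liftQ ((D'.fil i).mkQ ∘ₗ φ ∘ₗ (D.fil i).subtype)
      fun x hx => (Submodule.Quotient.mk_eq_zero _).2
        (D'.fil_mono (sub_le_self i zero_le_one) (hφi x hx))
  have hrange : LinearMap.range φbar ≤ LinearMap.range ((D'.fil i).mkQ ∘ₗ D'.diff) := by
    rintro _ ⟨p, rfl⟩
    obtain ⟨x, rfl⟩ := Submodule.Quotient.mk_surjective _ p
    obtain ⟨z, hz⟩ := D'.exists_sub_diff_mem_fil hD' hi (y := φ x)
      (hφ x ▸ hφi _ (D.diff_fil i x x.2))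
    exact ⟨z, ((Submodule.Quotient.eq _).2 hz).symm⟩
  obtain ⟨g, hg⟩ := exists_comp_eq_of_range_le φbar ((D'.fil i).mkQ ∘ₗ D'.diff) hrange
  refine ⟨g, fun x => (Submodule.Quotient.eq _).1 ?_⟩
  exact (LinearMap.congr_fun hg (Submodule.Quotient.mk x)).symm

theorem exists_deform_flagPreservingUpTo (hD : D.IsProjective) (hD' : D'.AnchoredOnResolution)
    {φ : D.carrier →ₗ[R] D'.carrier} (hφ : ∀ x, D'.diff (φ x) = φ (D.diff x)) {i : ℤ}
    (hi : 0 ≤ i) (hφi : FlagPreservingUpTo D D' (i - 1) φ) :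
    ∃ u : D.carrier →ₗ[R] D'.carrier,
      (∀ x ∈ D.fil (i - 1), u x = 0) ∧ FlagPreservingUpTo D D' i (DM.deform φ u) := by
  obtain ⟨g, hg⟩ := exists_gr_lift_boundary hD hD' hφ hi (hφi (i - 1) le_rfl)
  obtain ⟨u, hu⟩ := D.exists_linearMap_extending hD i
    (g ∘ₗ ((D.fil (i - 1)).submoduleOf (D.fil i)).mkQ)
  have hle : D.fil (i - 1) ≤ D.fil i := D.fil_mono (sub_le_self i zero_le_one)
  have hu_zero (x : D.carrier) (hx : x ∈ D.fil (i - 1)) : u x = 0 := by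
    have hmk : ((D.fil (i - 1)).submoduleOf (D.fil i)).mkQ ⟨x, hle hx⟩ = 0 :=
      (Submodule.Quotient.mk_eq_zero _).2 hx
    rw [hu ⟨x, hle hx⟩, LinearMap.comp_apply, hmk, map_zero]
  refine ⟨u, hu_zero, fun k hk x hx => ?_⟩
  have hdx : u (D.diff x) = 0 :=
    hu_zero _ (D.fil_mono (sub_le_sub_right hk 1) (D.diff_fil k x hx))
  rw [DM.deform_apply, hdx, add_zero]
  obtain rfl | hki := hk.eq_or_lt
  · rw [hu ⟨x, hx⟩]
    exact hg ⟨x, hx⟩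
  · have hki' : k ≤ i - 1 := Int.le_sub_one_of_lt hki
    rw [hu_zero x (D.fil_mono hki' hx), map_zero, sub_zero]
    exact hφi k hki' x hx

theorem exists_seq_deform_flagPreservingUpTo (hD : D.IsProjective)
    (hD' : D'.AnchoredOnResolution) {φ : D.carrier →ₗ[R] D'.carrier}
    (hφ : ∀ x, D'.diff (φ x) = φ (D.diff x)) :
    ∃ h : ℕ → D.carrier →ₗ[R] D'.carrier,
      (∀ n : ℕ, FlagPreservingUpTo D D' (n - 1) (DM.deform φ (h n))) ∧
        ∀ n : ℕ, ∀ x ∈ D.fil (n - 1), h (n + 1) x = h n x := by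
  have hstep (n : ℕ) (h : D.carrier →ₗ[R] D'.carrier)
      (hh : FlagPreservingUpTo D D' (n - 1) (DM.deform φ h)) :
      ∃ h' : D.carrier →ₗ[R] D'.carrier, FlagPreservingUpTo D D' n (DM.deform φ h') ∧
        ∀ x ∈ D.fil (n - 1), h' x = h x := by
    obtain ⟨u, hu, hpres⟩ := exists_deform_flagPreservingUpTo hD hD' (DM.diff_deform hφ h)
      n.cast_nonneg hh
    refine ⟨h + u, DM.deform_deform φ h u ▸ hpres, fun x hx => ?_⟩
    rw [LinearMap.add_apply, hu x hx, add_zero]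
  choose! next hpres hagree using hstep
  let h (n : ℕ) : D.carrier →ₗ[R] D'.carrier := Nat.rec 0 next n
  have hh (n : ℕ) : FlagPreservingUpTo D D' (n - 1) (DM.deform φ (h n)) := by
    induction n with
    | zero =>
      intro k hk x hx
      have hx0 : x = 0 := by
        simpa only [D.fil_neg k (by omega), Submodule.mem_bot] using hx
      rw [hx0, map_zero]
      exact zero_mem _
    | succ n ih =>
      rw [Nat.cast_succ, add_sub_cancel_right]
      exact hpres n (h n) ih
  exact ⟨h, hh, fun n => hagree n (h n) (hh n)⟩

theorem exists_deform_flagPreserving (hD : D.IsProjective) (hD' : D'.AnchoredOnResolution)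
    {φ : D.carrier →ₗ[R] D'.carrier} (hφ : ∀ x, D'.diff (φ x) = φ (D.diff x)) :
    ∃ h : D.carrier →ₗ[R] D'.carrier, FlagPreserving D D' (DM.deform φ h) := by
  obtain ⟨h, hpres, hagree⟩ := exists_seq_deform_flagPreservingUpTo hD hD' hφ
  have hmono : Monotone fun n : ℕ => (h n).toPMap (D.fil (n - 1)) :=
    monotone_nat_of_le_succ fun n => ⟨D.fil_mono (by omega), fun x y hxy =>
      (hagree n x x.2).symm.trans (congrArg (h (n + 1)) hxy)⟩
  have hmem {x : D.carrier} {i : ℤ} (hx : x ∈ D.fil i) : x ∈ D.fil ((i.toNat + 1 : ℕ) - 1) :=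
    D.fil_mono (by omega) hx
  obtain ⟨H, hH⟩ := exists_linearMap_of_directed _ hmono.directed_le fun x =>
    (D.fil_exhaustive x).imp' (fun i => i.toNat + 1) fun _ => hmem
  refine ⟨H, fun i x hx => ?_⟩
  set n := i.toNat + 1
  have hHx : H x = h n x := hH n ⟨x, hmem hx⟩
  have hHdx : H (D.diff x) = h n (D.diff x) :=
    hH n ⟨D.diff x, hmem (D.fil_mono (sub_le_self i zero_le_one) (D.diff_fil i x hx))⟩
  rw [DM.deform_apply, hHx, hHdx]
  exact hpres n i (by omega) x hx

end Homotopy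

end Flag

end DiffMod

theorem theorem1p1_general {R : Type u} [CommRing R] {A : Type t} [AddCommGroup A] [DecidableEq A]
    (𝓡 : A → AddSubgroup R) [GradedRing 𝓡] (a : A) (d : ℕ)
    (D : DiffMod.Flag.{u, v, t} 𝓡 a d) (D' : DiffMod.Flag.{u, w, t} 𝓡 a d)
    (hD : D.IsProjective) (hD' : D'.AnchoredOnResolution)
    (φ : D.carrier →ₗ[R] D'.carrier) (hφ : DiffMod.IsMorphism D.toDM D'.toDM φ) :
    ∃ ψ h : D.carrier →ₗ[R] D'.carrier,
      DiffMod.IsMorphism D.toDM D'.toDM ψ ∧ DiffMod.Flag.FlagPreserving D D' ψ ∧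
        DiffMod.IsHomotopy D.toDM D'.toDM φ ψ h := by
  obtain ⟨k, hk⟩ := DiffMod.Flag.exists_deform_flagPreserving hD hD' hφ.comm
  let h := D.component D'.toDM (-a, 1) k
  have hψ : D.component D'.toDM 0 (DiffMod.DM.deform φ k) = DiffMod.DM.deform φ h :=
    DiffMod.DM.component_deform hφ.isHomogeneousHom k
  refine ⟨DiffMod.DM.deform φ h, h, ⟨?_, DiffMod.DM.diff_deform hφ.comm h⟩, ?_, ?_, ?_⟩
  · exact fun b j x hx => hψ ▸ by
      simpa using DiffMod.DM.component_mem (D := D.toDM) 0 (DiffMod.DM.deform φ k) hx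
  · exact fun i x hx => hψ ▸ DiffMod.homogeneousComponent_mem D.piece D'.piece
      (D.fil_homogeneous i) (D'.fil_homogeneous i) 0 (hk i) hx
  · exact fun b j x hx => by
      simpa [sub_eq_add_neg] using DiffMod.DM.component_mem (D := D.toDM) (-a, 1) k hx
  · exact sub_sub_cancel φ _

theorem theorem1p1 {R : Type u} [CommRing R] {A : Type t} [AddCommGroup A] [DecidableEq A]
    (𝓡 : A → AddSubgroup R) [GradedRing 𝓡] (a : A) (d : ℕ)
    (D : DiffMod.Flag.{u, v, t} 𝓡 a d) (D' : DiffMod.Flag.{u, w, t} 𝓡 a d)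
    (hD : D.IsProjective) (hD' : D'.IsProjective)
    (hDres : D.AnchoredOnResolution) (hD'res : D'.AnchoredOnResolution)
    (φ : D.carrier →ₗ[R] D'.carrier) (hφ : DiffMod.IsMorphism D.toDM D'.toDM φ) :
    ∃ ψ h : D.carrier →ₗ[R] D'.carrier,
      DiffMod.IsMorphism D.toDM D'.toDM ψ ∧ DiffMod.Flag.FlagPreserving D D' ψ ∧
        DiffMod.IsHomotopy D.toDM D'.toDM φ ψ h :=
  theorem1p1_general 𝓡 a d D D' hD hD'res φ hφ
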